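/- **Conventions.** A (finite) ribbon graph $G=(V(G),E(G))$ is a (possibly non-orientable) surface with boundary that is the union of a finite set $V(G)$ of closed discs (vertices) and a finite set $E(G)$ of closed discs (edges), such that vertices and edges meet in disjoint line segments, each segment lies on the boundary of exactly one vertex and exactly one edge, and each edge contains exactly two segments; ribbon graphs are considered up to equivalence. Connected ribbon graphs are non-empty. A ribbon subgraph of $G$ is obtained by deleting edges and vertices; for $A\subseteq E(G)$ write $A^c=E(G)\setminus A$, let $G|_A$ be the ribbon subgraph consisting of the edges in $A$ and their incident vertices, and let $G-A=(V(G),A^c)$. $G$ is orientable if it is orientable as a surface. For connected $G$, let $g(G)$ be the genus of the closed surface obtained by capping off the boundary components of $G$ with discs; the Euler genus is $\gamma(G)=2g(G)$ if $G$ is orientable and $\gamma(G)=g(G)$ otherwise. In general, $\gamma(G)$ is the sum of the Euler genera of the components of $G$. The partial dual $G^A$ is the ribbon graph defined as follows: orient the boundary of each edge of $G$ arbitrarily; the boundary components of the spanning ribbon subgraph $(V(G),A)$ meet each edge $e\in E(G)$ in two disjoint arcs; on each of them place an arrow labelled $e$ in the direction of the orientation of the boundary of $e$. The vertices of $G^A$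 are discs bounded by these marked boundary components, and its edges are discs $e\in E(G)$, the disc $e$ being attached along the two arrows labelled $e$, in agreement with the orientation of its boundary. A connected ribbon graph $T$ is a $1$-sum $P\oplus Q$ of connected ribbon subgraphs $P,Q$, each having at least one edge, if $T=P\cup Q$ and $P\cap Q$ is a single vertex. For $G$ connected, $A\subseteq E(G)$ defines a biseparation of $G$ if $A=\emptyset$, or $A=E(G)$, or one can list the components of $G|_A$ and of $G|_{A^c}$, each exactly once, as $H_1,\dots,H_l$ so that $G=(\cdots((H_1\oplus H_2)\oplus H_3)\oplus\cdots)\oplus H_l$, where each $1$-sum involves a component of $G|_A$ and a component of $G|_{A^c}$ (that is, the vertex at which $H_{j}$ is added lies in some $H_i$, $i<j$, with one of $H_i,H_j$ a component of $G|_A$ and the other a component of $G|_{A^c}$). **Theorem.** Let $G$ be a connected ribbon graph and $A\subseteq E(G)$. Then $A$ defines a biseparation of $G$ if and only if $$\gamma(G^A)=\gamma(G|_A)+\gamma(G-A).$$ Furthermore, if $A$ defines a biseparation of $G$, then $G^A$ is orientable if and only if both $G|_A$ and $G-A$ are orientable. -/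

import Mathlib

/-!
Ribbon graphs, recorded through the corners of their edge discs.

A ribbon graph is a surface that is the union of vertex discs and edge discs.  Each edge disc meets
the vertex discs in two disjoint segments, so its boundary circle is cut by four points, its
*corners*, into four arcs: segment, free side, segment, free side.  The boundary circle of a vertex
disc is cut by the corners lying on it into arcs that are alternately segments (where an edge disc is
glued on) and gaps (where none is); a vertex disc that meets no edge disc carries no corner.  Up to
equivalence a ribbon graph is determined by saying which corners are the two ends of a common
segment, of a common free side, and of a common gap.  This is the arrow presentation of the ribbon
graph: the segments are the marking arrows, and the corners their heads and tails.
-/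

/-- A ribbon graph with vertex discs `V`, edge discs `E` and corners `F`. -/
structure RibbonGraph (V E F : Type*) where
  /-- the vertex disc on whose boundary a corner lies -/
  vert : F → V
  /-- the edge disc of which a point is a corner -/
  edge : F → E
  /-- the other end of the segment (common arc of an edge disc and a vertex disc) at a corner -/
  seg : F → F
  /-- the other end of the free side of the edge disc at a corner -/
  side : F → F
  /-- the other end of the gap (arc of the vertex boundary that meets no edge disc) at a corner -/
  gap : F → F
  seg_seg : ∀ f, seg (seg f) = f
  side_side : ∀ f, side (side f) = f
  gap_gap : ∀ f, gap (gap f) = f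
  seg_ne : ∀ f, seg f ≠ f
  side_ne : ∀ f, side f ≠ f
  gap_ne : ∀ f, gap f ≠ f
  seg_ne_side : ∀ f, seg f ≠ side f
  seg_side : ∀ f, seg (side f) = side (seg f)
  edge_surjective : Function.Surjective edge
  /-- the boundary of an edge disc is the circle made of its two segments and two free sides -/
  edge_eq_iff : ∀ f f', edge f = edge f' ↔
    f' = f ∨ f' = seg f ∨ f' = side f ∨ f' = seg (side f)
  /-- the boundary of a vertex disc is a single circle, made of segments and gaps -/
  vert_eq_iff : ∀ f f', vert f = vert f' ↔
    Relation.EqvGen (fun a b => b = seg a ∨ b = gap a) f f'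

/-- A ribbon subgraph of `G`: some of the vertex discs and some of the edge discs of `G`, among the
vertex discs all those that the chosen edge discs meet. -/
@[ext]
structure RibbonSubgraph {V E F : Type*} (G : RibbonGraph V E F) where
  verts : Set V
  edges : Set E
  vert_mem : ∀ f, G.edge f ∈ edges → G.vert f ∈ verts

namespace RibbonGraph

variable {V E F : Type*} (G : RibbonGraph V E F)

/-- `G` as a ribbon subgraph of itself. -/
def whole : RibbonSubgraph G where
  verts := Set.univ
  edges := Set.univ
  vert_mem := fun _ _ => Set.mem_univ _

/-- The spanning ribbon subgraph `(V(G), A)`. -/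
def spanning (A : Set E) : RibbonSubgraph G where
  verts := Set.univ
  edges := A
  vert_mem := fun _ _ => Set.mem_univ _

/-- `G - A`: delete the edges in `A`, keep all vertices. -/
def delete (A : Set E) : RibbonSubgraph G := G.spanning Aᶜ

/-- `G|_A`, the ribbon subgraph induced by `A`: the edges in `A` and their incident vertices. -/
def restrict (A : Set E) : RibbonSubgraph G where
  verts := {v | ∃ f, G.edge f ∈ A ∧ G.vert f = v}
  edges := A
  vert_mem := fun f hf => ⟨f, hf, rfl⟩

open Classical in
/-- When the edge discs outside `B` are deleted, a corner is an end of exactly one boundary arc that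
is not a gap: the free side of its edge disc if the edge is in `B`, and otherwise the segment
where its deleted edge disc was attached.  `arc B f` is the other end of that arc. -/
noncomputable def arc (B : Set E) (f : F) : F :=
  if G.edge f ∈ B then G.side f else G.seg f

end RibbonGraph

namespace RibbonSubgraph

variable {V E F : Type*} {G : RibbonGraph V E F} (H : RibbonSubgraph G)

/-- The corners of `G` that lie on vertex discs of `H`. -/
abbrev Corner : Type _ := {f : F // G.vert f ∈ H.verts}

/-- Two corners on `H` are ends of a common arc of the boundary of the surface `H`. -/
def BdryStep (x y : H.Corner) : Prop :=
  y.1 = G.gap x.1 ∨ y.1 = G.arc H.edges x.1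

/-- The boundary components of the surface `H`: the circles obtained by following boundary arcs from
corner to corner, and the boundary circles of the vertex discs of `H` that carry no corner. -/
abbrev BdryComponent : Type _ :=
  Quotient (Relation.EqvGen.setoid H.BdryStep) ⊕ {v : V // v ∈ H.verts ∧ ∀ f, G.vert f ≠ v}

/-- Some edge disc of `H` joins the vertex discs `v` and `w`. -/
def Adj (v w : V) : Prop :=
  ∃ f, G.edge f ∈ H.edges ∧ G.vert f = v ∧ G.vert (G.side f) = w

/-- `v` and `w` are joined by a path of edges of `H`. -/
def Reachable (v w : V) : Prop := Relation.ReflTransGen H.Adj v w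

/-- `H` is connected (in particular not empty). -/
def Connected : Prop :=
  H.verts.Nonempty ∧ ∀ v ∈ H.verts, ∀ w ∈ H.verts, H.Reachable v w

/-- The component of `H` that contains the vertex `v` of `H`. -/
def componentAt (v : V) : RibbonSubgraph G where
  verts := {w | w ∈ H.verts ∧ H.Reachable v w}
  edges := {e | e ∈ H.edges ∧ ∀ f, G.edge f = e → H.Reachable v (G.vert f)}
  vert_mem := fun f hf => ⟨H.vert_mem f hf.1, hf.2 f rfl⟩

/-- The set of components of `H`, each regarded as a ribbon subgraph of `G`. -/
def components : Set (RibbonSubgraph G) := {K | ∃ v ∈ H.verts, K = H.componentAt v}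

/-- The surface `H` is orientable: its discs have orientations that are compatible along the
segments.  `o f` tells whether the chosen orientation of the vertex disc at `f` runs along the
segment at `f` away from `f`, or towards `f`; so `o` changes along segments and gaps, and an edge disc
of `H` has a compatible orientation iff `o` also changes along its free sides. -/
def Orientable : Prop :=
  ∃ o : F → Bool,
    (∀ f, G.vert f ∈ H.verts → o (G.seg f) = !(o f) ∧ o (G.gap f) = !(o f)) ∧
    (∀ f, G.edge f ∈ H.edges → o (G.side f) = !(o f))

/-- The Euler characteristic of the closed surface obtained from `H` by capping off every boundary
component with a disc (used for finite `H`). -/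
noncomputable def cappedEulerChar : ℤ :=
  (H.verts.ncard : ℤ) - (H.edges.ncard : ℤ) + (Nat.card H.BdryComponent : ℤ)

open Classical in
/-- The genus of a connected ribbon graph `H` viewed as a punctured surface: a closed connected
surface of genus `g` has Euler characteristic `2 - 2 g` if it is orientable and `2 - g` if not. -/
noncomputable def connGenus : ℚ :=
  if H.Orientable then (2 - (H.cappedEulerChar : ℚ)) / 2 else 2 - (H.cappedEulerChar : ℚ)

open Classical in
/-- The Euler genus of a connected ribbon graph: `2 g` if it is orientable and `g` if not. -/
noncomputable def connEulerGenus : ℚ :=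
  if H.Orientable then 2 * H.connGenus else H.connGenus

/-- The Euler genus of a ribbon graph: the sum of the Euler genera of its components. -/
noncomputable def eulerGenus : ℚ := ∑ᶠ K ∈ H.components, K.connEulerGenus

/-- `T = P ⊕ Q`, a 1-sum occurring at `v`: `P` and `Q` are connected and non-trivial (neither is an
isolated vertex), `T = P ∪ Q` and `P ∩ Q = {v}`. -/
structure IsOneSumAt (T P Q : RibbonSubgraph G) (v : V) : Prop where
  left_connected : P.Connected
  right_connected : Q.Connected
  left_nontrivial : P.edges.Nonempty
  right_nontrivial : Q.edges.Nonempty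
  verts_union : T.verts = P.verts ∪ Q.verts
  edges_union : T.edges = P.edges ∪ Q.edges
  verts_inter : P.verts ∩ Q.verts = {v}
  edges_inter : P.edges ∩ Q.edges = ∅

end RibbonSubgraph

namespace RibbonGraph

variable {V E F : Type*} (G : RibbonGraph V E F)

/-- `G` is connected. -/
def Connected : Prop := G.whole.Connected

/-- `G` is orientable as a surface. -/
def Orientable : Prop := G.whole.Orientable

/-- The Euler genus of `G`. -/
noncomputable def eulerGenus : ℚ := G.whole.eulerGenus

/-- `A` defines a biseparation of `G`: either `A` is trivial, or
`G = (⋯ ((H 0 ⊕ H 1) ⊕ H 2) ⊕ ⋯) ⊕ H l`, where `H 0, …, H l` are the components of `G|_A` and of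
`G|_{Aᶜ}`, each listed once, and each 1-sum (the one that adds `H (j + 1)` to the sum `S j` of
`H 0, …, H j`, at a vertex `v`) involves a component of `G|_A` and a component of `G|_{Aᶜ}`. -/
def DefinesBiseparation (A : Set E) : Prop :=
  A = Set.univ ∨ A = ∅ ∨
  ∃ (l : ℕ) (H S : ℕ → RibbonSubgraph G),
    Set.InjOn H (Set.Iic l) ∧
    H '' Set.Iic l = (G.restrict A).components ∪ (G.restrict Aᶜ).components ∧
    S 0 = H 0 ∧
    S l = G.whole ∧
    ∀ j < l, ∃ v, RibbonSubgraph.IsOneSumAt (S (j + 1)) (S j) (H (j + 1)) v ∧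
      ∃ i ≤ j, v ∈ (H i).verts ∧
        ((H i ∈ (G.restrict A).components ∧ H (j + 1) ∈ (G.restrict Aᶜ).components) ∨
         (H i ∈ (G.restrict Aᶜ).components ∧ H (j + 1) ∈ (G.restrict A).components))

theorem edge_seg (f : F) : G.edge (G.seg f) = G.edge f :=
  ((G.edge_eq_iff f (G.seg f)).2 (Or.inr (Or.inl rfl))).symm

theorem edge_side (f : F) : G.edge (G.side f) = G.edge f :=
  ((G.edge_eq_iff f (G.side f)).2 (Or.inr (Or.inr (Or.inl rfl)))).symm

theorem edge_arc (B : Set E) (f : F) : G.edge (G.arc B f) = G.edge f := by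
  unfold arc; split_ifs
  · exact G.edge_side f
  · exact G.edge_seg f

theorem arc_of_mem {B : Set E} {f : F} (h : G.edge f ∈ B) : G.arc B f = G.side f := if_pos h

theorem arc_of_not_mem {B : Set E} {f : F} (h : G.edge f ∉ B) : G.arc B f = G.seg f := if_neg h

theorem arc_arc (B : Set E) (f : F) : G.arc B (G.arc B f) = f := by
  by_cases h : G.edge f ∈ B
  · rw [G.arc_of_mem h, G.arc_of_mem (by rwa [G.edge_side]), G.side_side]
  · rw [G.arc_of_not_mem h, G.arc_of_not_mem (by rwa [G.edge_seg]), G.seg_seg]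

theorem arc_ne (B : Set E) (f : F) : G.arc B f ≠ f := by
  by_cases h : G.edge f ∈ B
  · rw [G.arc_of_mem h]; exact G.side_ne f
  · rw [G.arc_of_not_mem h]; exact G.seg_ne f

theorem arc_compl_of_mem {B : Set E} {f : F} (h : G.edge f ∈ B) : G.arc Bᶜ f = G.seg f :=
  G.arc_of_not_mem (fun h' => h' h)

theorem arc_compl_of_not_mem {B : Set E} {f : F} (h : G.edge f ∉ B) : G.arc Bᶜ f = G.side f :=
  G.arc_of_mem h

/-- The boundary component of the spanning ribbon subgraph `(V(G), A)` that passes through `f`. -/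
def spanningBdry (A : Set E) (f : F) : (G.spanning A).BdryComponent :=
  Sum.inl (Quotient.mk _ ⟨f, Set.mem_univ _⟩)

theorem spanningBdry_eq_iff (A : Set E) (f f' : F) :
    G.spanningBdry A f = G.spanningBdry A f' ↔
      Relation.EqvGen (fun a b => b = G.arc A a ∨ b = G.gap a) f f' := by
  unfold spanningBdry
  rw [Sum.inl.injEq, Quotient.eq]
  constructor
  · intro h
    have key : ∀ x y : (G.spanning A).Corner, Relation.EqvGen (G.spanning A).BdryStep x y →
        Relation.EqvGen (fun a b => b = G.arc A a ∨ b = G.gap a) x.1 y.1 := by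
      intro x y hxy
      induction hxy with
      | rel x y h => exact Relation.EqvGen.rel _ _ (Or.symm h)
      | refl x => exact Relation.EqvGen.refl _
      | symm x y _ ih => exact Relation.EqvGen.symm _ _ ih
      | trans x y z _ _ ih1 ih2 => exact Relation.EqvGen.trans _ _ _ ih1 ih2
    exact key _ _ h
  · intro h
    change Relation.EqvGen (G.spanning A).BdryStep _ _
    induction h with
    | rel x y h => exact Relation.EqvGen.rel _ _ (Or.symm h)
    | refl x => exact Relation.EqvGen.refl _
    | symm x y _ ih => exact Relation.EqvGen.symm _ _ ih
    | trans x y z _ _ ih1 ih2 => exact Relation.EqvGen.trans _ _ _ ih1 ih2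

/-- The partial dual `G^A`.  Its vertex discs are bounded by the boundary components of the spanning
ribbon subgraph `(V(G), A)`.  Those meet an edge disc `e` of `G` in the two free sides of `e` if
`e ∈ A`, and in the two segments of `e` if `e ∉ A`; these arcs (directed along the boundary of `e`) are
the marking arrows of `G^A` labelled `e`, that is, the segments of the edge disc `e` of `G^A`.  The
other two arcs of the boundary of `e` join the head of each of the two arrows to the tail of the other:
they are the free sides of the edge disc `e` of `G^A`.  The gaps are those of `G`. -/
noncomputable def partialDual (A : Set E) :
    RibbonGraph (G.spanning A).BdryComponent E F where
  vert := G.spanningBdry A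
  edge := G.edge
  seg := G.arc A
  side := G.arc Aᶜ
  gap := G.gap
  seg_seg := G.arc_arc A
  side_side := G.arc_arc Aᶜ
  gap_gap := G.gap_gap
  seg_ne := G.arc_ne A
  side_ne := G.arc_ne Aᶜ
  gap_ne := G.gap_ne
  seg_ne_side := fun f => by
    by_cases h : G.edge f ∈ A
    · rw [G.arc_of_mem h, G.arc_compl_of_mem h]; exact (G.seg_ne_side f).symm
    · rw [G.arc_of_not_mem h, G.arc_compl_of_not_mem h]; exact G.seg_ne_side f
  seg_side := fun f => by
    by_cases h : G.edge f ∈ A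
    · rw [G.arc_compl_of_mem h, G.arc_of_mem h, G.arc_of_mem (by rwa [G.edge_seg]),
        G.arc_compl_of_mem (by rwa [G.edge_side]), G.seg_side]
    · rw [G.arc_compl_of_not_mem h, G.arc_of_not_mem h, G.arc_of_not_mem (by rwa [G.edge_side]),
        G.arc_compl_of_not_mem (by rwa [G.edge_seg]), G.seg_side]
  edge_surjective := G.edge_surjective
  edge_eq_iff := fun f f' => by
    rw [G.edge_eq_iff]
    by_cases h : G.edge f ∈ A
    · rw [G.arc_compl_of_mem h, G.arc_of_mem h, G.arc_of_mem (by rwa [G.edge_seg]), G.seg_side]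
      tauto
    · rw [G.arc_compl_of_not_mem h, G.arc_of_not_mem h, G.arc_of_not_mem (by rwa [G.edge_side])]
  vert_eq_iff := G.spanningBdry_eq_iff A

end RibbonGraph

/-! Whether or not a connected surface is orientable, its Euler genus is 2 minus its capped Euler
characteristic. Vertices, edges and boundary components are additive over components, so a ribbon
graph with c components, v vertices, e edges and b boundary circles has γ = 2c - v + e - b
(`RibbonSubgraph.eulerGenus_eq`). Replacing G|_A by the spanning subgraph (V, A) only adds isolated
discs, of genus 0. The partial dual G^A is connected, its vertices are the boundary circles of (V,
A), and its own boundary circles are those of (V, A^c). In the genus equation all boundary counts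
therefore cancel, leaving c(A) + c(A^c) = |V| + 1 (`eulerGenus_partialDual_eq_iff`).

This is a tree condition. Call the components of G|_A and G|_{A^c} pieces. For a list H 0, ..., H l
of all pieces it reads |V| + l = Σ |V(H i)|. Connectedness of G gives a list in which each piece
meets the union of the earlier ones. The l overlaps then sum to l and each is at least 1, so each is
a single vertex: every addition is a 1-sum. Conversely, each 1-sum identifies exactly one vertex.

For orientability, partial duality only exchanges segments and free sides on the edges of A, and an
orientation must change along both kinds of arc, so G^A is orientable exactly when G is.
Orientations of the pieces glue along 1-sums after a global flip of one summand. -/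

theorem Finset.sum_natCard_of_bijective {ι α : Type*} (s : Finset ι) (β : ι → Type*)
    [∀ i, Finite (β i)] (φ : (Σ i : s, β i) → α) (hφ : Function.Bijective φ) :
    ∑ i ∈ s, Nat.card (β i) = Nat.card α := by
  rw [← Nat.card_eq_of_bijective φ hφ, Nat.card_sigma, ← Finset.sum_coe_sort]

namespace RibbonGraph

variable {V E F : Type*} (G : RibbonGraph V E F)

theorem finite_corners (G : RibbonGraph V E F) [Finite E] : Finite F := by
  refine Set.finite_univ_iff.1 ((Set.finite_univ (α := E)).preimage' (f := G.edge) fun e _ => ?_)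
  obtain ⟨f, rfl⟩ := G.edge_surjective e
  refine Set.Finite.subset
    (Set.toFinite ({f, G.seg f, G.side f, G.seg (G.side f)} : Set F)) fun x hx => ?_
  have := (G.edge_eq_iff f x).1 (Eq.symm hx)
  simpa using this

theorem vert_seg (f : F) : G.vert (G.seg f) = G.vert f :=
  ((G.vert_eq_iff f _).2 (Relation.EqvGen.rel _ _ (Or.inl rfl))).symm

theorem vert_gap (f : F) : G.vert (G.gap f) = G.vert f :=
  ((G.vert_eq_iff f _).2 (Relation.EqvGen.rel _ _ (Or.inr rfl))).symm

/-- An isolated vertex disc, as a ribbon subgraph. -/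
def disc (v : V) : RibbonSubgraph G where
  verts := {v}
  edges := ∅
  vert_mem := fun _ h => h.elim

end RibbonGraph

/-! ### Components, and additivity of the Euler characteristic. -/

namespace RibbonSubgraph

variable {V E F : Type*} {G : RibbonGraph V E F} (H : RibbonSubgraph G)

/-- The factor 2 of the orientable case cancels the 1/2 in the genus, so orientability plays no part
in the genus formula. -/
theorem connEulerGenus_eq : H.connEulerGenus = 2 - (H.cappedEulerChar : ℚ) := by
  unfold connEulerGenus connGenus
  split_ifs <;> ring

theorem adj_symm {v w : V} (h : H.Adj v w) : H.Adj w v := by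
  obtain ⟨f, hf, rfl, rfl⟩ := h
  exact ⟨G.side f, by rwa [G.edge_side], rfl, by rw [G.side_side]⟩

theorem Reachable.symm {H : RibbonSubgraph G} {v w : V} (h : H.Reachable v w) :
    H.Reachable w v := by
  induction h with
  | refl => exact Relation.ReflTransGen.refl
  | tail _ h ih => exact Relation.ReflTransGen.head (H.adj_symm h) ih

theorem Reachable.trans {H : RibbonSubgraph G} {u v w : V} (h : H.Reachable u v)
    (h' : H.Reachable v w) : H.Reachable u w := Relation.ReflTransGen.trans h h'

theorem reachable_refl (v : V) : H.Reachable v v := Relation.ReflTransGen.refl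

theorem reachable_of_edge_eq {f f' : F} (hf : G.edge f ∈ H.edges) (h : G.edge f = G.edge f') :
    H.Reachable (G.vert f) (G.vert f') := by
  have hs : H.Reachable (G.vert f) (G.vert (G.side f)) :=
    Relation.ReflTransGen.single ⟨f, hf, rfl, rfl⟩
  rcases (G.edge_eq_iff f f').1 h with rfl | rfl | rfl | rfl
  · exact H.reachable_refl _
  · rw [G.vert_seg]; exact H.reachable_refl _
  · exact hs
  · rwa [G.vert_seg]

theorem Reachable.mem {H : RibbonSubgraph G} {v w : V} (h : H.Reachable v w)
    (hv : v ∈ H.verts) : w ∈ H.verts := by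
  induction h with
  | refl => exact hv
  | tail _ h _ =>
    obtain ⟨f, hf, rfl, rfl⟩ := h
    exact H.vert_mem _ (by rwa [G.edge_side])

theorem mem_componentAt_self {v : V} (hv : v ∈ H.verts) : v ∈ (H.componentAt v).verts :=
  ⟨hv, H.reachable_refl v⟩

theorem componentAt_eq_of_reachable {v w : V} (h : H.Reachable v w) :
    H.componentAt v = H.componentAt w := by
  have key : ∀ u, H.Reachable v u ↔ H.Reachable w u :=
    fun u => ⟨fun hu => h.symm.trans hu, fun hu => h.trans hu⟩
  ext u
  · simp only [componentAt, Set.mem_ofPred_eq, key]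
  · simp only [componentAt, Set.mem_ofPred_eq, key]

theorem components_finite [Finite V] : H.components.Finite := by
  have : H.components = H.componentAt '' H.verts := by
    ext K; simp [components, eq_comm]
  rw [this]
  exact (Set.toFinite _).image _

variable {H} {K K' : RibbonSubgraph G}

theorem eq_componentAt_of_mem (hK : K ∈ H.components) {v : V} (hv : v ∈ K.verts) :
    K = H.componentAt v := by
  obtain ⟨u, -, rfl⟩ := hK
  exact H.componentAt_eq_of_reachable hv.2

theorem component_verts_subset (hK : K ∈ H.components) : K.verts ⊆ H.verts := by
  obtain ⟨u, -, rfl⟩ := hK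
  exact fun _ h => h.1

theorem component_edges_subset (hK : K ∈ H.components) : K.edges ⊆ H.edges := by
  obtain ⟨u, -, rfl⟩ := hK
  exact fun _ h => h.1

theorem component_verts_nonempty (hK : K ∈ H.components) : K.verts.Nonempty := by
  obtain ⟨u, hu, rfl⟩ := hK
  exact ⟨u, H.mem_componentAt_self hu⟩

theorem component_eq_of_mem (hK : K ∈ H.components) (hK' : K' ∈ H.components) {v : V}
    (hv : v ∈ K.verts) (hv' : v ∈ K'.verts) : K = K' :=
  (eq_componentAt_of_mem hK hv).trans (eq_componentAt_of_mem hK' hv').symm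

/-- An edge joins all the vertices it touches, so a single corner decides which component contains
it. -/
theorem component_edge_mem_iff (hK : K ∈ H.components) (f : F) :
    G.edge f ∈ K.edges ↔ G.edge f ∈ H.edges ∧ G.vert f ∈ K.verts := by
  refine ⟨fun h => ⟨component_edges_subset hK h, K.vert_mem f h⟩, fun ⟨h, h'⟩ => ?_⟩
  rw [eq_componentAt_of_mem hK h']
  exact ⟨h, fun f' hf' => H.reachable_of_edge_eq h hf'.symm⟩

theorem component_connected (hK : K ∈ H.components) : K.Connected := by
  refine ⟨component_verts_nonempty hK, fun v hv w hw => ?_⟩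
  have hvw : H.Reachable v w := by
    rw [eq_componentAt_of_mem hK hv] at hw
    exact hw.2
  clear hw
  induction hvw using Relation.ReflTransGen.head_induction_on with
  | refl => exact K.reachable_refl _
  | head h _ ih =>
    obtain ⟨f, hf, rfl, rfl⟩ := h
    have hfK : G.edge f ∈ K.edges := (component_edge_mem_iff hK f).2 ⟨hf, hv⟩
    exact Relation.ReflTransGen.head ⟨f, hfK, rfl, rfl⟩
      (ih (K.vert_mem _ (by rwa [G.edge_side])))

theorem components_of_connected (hH : H.Connected) : H.components = {H} := by
  have key : ∀ v ∈ H.verts, H.componentAt v = H := by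
    intro v hv
    ext w
    · exact ⟨fun h => h.1, fun h => ⟨h, hH.2 v hv w h⟩⟩
    · exact ⟨fun h => h.1, fun h => ⟨h, fun f hf => hH.2 v hv _ (H.vert_mem f (by rwa [hf]))⟩⟩
  ext K
  constructor
  · rintro ⟨v, hv, rfl⟩
    exact key v hv
  · rintro rfl
    obtain ⟨v, hv⟩ := hH.1
    exact ⟨v, hv, (key v hv).symm⟩

variable (H)

theorem sum_component_verts [Finite V] :
    ∑ K ∈ H.components_finite.toFinset, K.verts.ncard = H.verts.ncard := by
  refine Finset.sum_natCard_of_bijective _ (fun K : RibbonSubgraph G => K.verts)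
    (fun x : (Σ K : H.components_finite.toFinset, K.1.verts) => (⟨x.2.1, component_verts_subset
      (H.components_finite.mem_toFinset.1 x.1.2) x.2.2⟩ : H.verts)) ⟨?_, ?_⟩
  · rintro ⟨⟨K, hK⟩, ⟨v, hv⟩⟩ ⟨⟨K', hK'⟩, ⟨v', hv'⟩⟩ h
    rw [Set.Finite.mem_toFinset] at hK hK'
    obtain rfl : v = v' := congrArg Subtype.val h
    obtain rfl := component_eq_of_mem hK hK' hv hv'
    rfl
  · rintro ⟨v, hv⟩
    exact ⟨⟨⟨H.componentAt v, H.components_finite.mem_toFinset.2 ⟨v, hv, rfl⟩⟩,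
      ⟨v, H.mem_componentAt_self hv⟩⟩, rfl⟩

theorem sum_component_edges [Finite V] [Finite E] :
    ∑ K ∈ H.components_finite.toFinset, K.edges.ncard = H.edges.ncard := by
  refine Finset.sum_natCard_of_bijective _ (fun K : RibbonSubgraph G => K.edges)
    (fun x : (Σ K : H.components_finite.toFinset, K.1.edges) => (⟨x.2.1, component_edges_subset
      (H.components_finite.mem_toFinset.1 x.1.2) x.2.2⟩ : H.edges)) ⟨?_, ?_⟩
  · rintro ⟨⟨K, hK⟩, ⟨e, he⟩⟩ ⟨⟨K', hK'⟩, ⟨e', he'⟩⟩ h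
    rw [Set.Finite.mem_toFinset] at hK hK'
    obtain rfl : e = e' := congrArg Subtype.val h
    obtain ⟨f, rfl⟩ := G.edge_surjective e
    obtain rfl := component_eq_of_mem hK hK' (K.vert_mem f he) (K'.vert_mem f he')
    rfl
  · rintro ⟨e, he⟩
    obtain ⟨f, rfl⟩ := G.edge_surjective e
    have hv := H.vert_mem f he
    have hK : H.componentAt (G.vert f) ∈ H.components := ⟨_, hv, rfl⟩
    exact ⟨⟨⟨_, H.components_finite.mem_toFinset.2 hK⟩,
      ⟨G.edge f, (component_edge_mem_iff hK f).2 ⟨he, H.mem_componentAt_self hv⟩⟩⟩, rfl⟩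

theorem vert_arc_mem {f : F} (h : G.vert f ∈ H.verts) : G.vert (G.arc H.edges f) ∈ H.verts := by
  by_cases hf : G.edge f ∈ H.edges
  · rw [G.arc_of_mem hf]
    exact H.vert_mem _ (by rwa [G.edge_side])
  · rwa [G.arc_of_not_mem hf, G.vert_seg]

variable {H}

theorem component_arc_eq (hK : K ∈ H.components) {f : F} (hf : G.vert f ∈ K.verts) :
    G.arc K.edges f = G.arc H.edges f := by
  by_cases h : G.edge f ∈ H.edges
  · rw [G.arc_of_mem h, G.arc_of_mem ((component_edge_mem_iff hK f).2 ⟨h, hf⟩)]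
  · rw [G.arc_of_not_mem h, G.arc_of_not_mem fun h' => h (component_edges_subset hK h')]

/-- A corner of a component, as a corner of the ribbon subgraph. -/
def cornerOfComponent (hK : K ∈ H.components) (x : K.Corner) : H.Corner :=
  ⟨x.1, component_verts_subset hK x.2⟩

theorem bdryStep_cornerOfComponent (hK : K ∈ H.components) {x y : K.Corner}
    (h : K.BdryStep x y) : H.BdryStep (cornerOfComponent hK x) (cornerOfComponent hK y) := by
  rcases h with h | h
  · exact Or.inl h
  · exact Or.inr (h.trans (component_arc_eq hK x.2))

theorem eqvGen_cornerOfComponent (hK : K ∈ H.components) {x y : K.Corner}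
    (h : Relation.EqvGen K.BdryStep x y) :
    Relation.EqvGen H.BdryStep (cornerOfComponent hK x) (cornerOfComponent hK y) := by
  induction h with
  | rel x y h => exact .rel _ _ (bdryStep_cornerOfComponent hK h)
  | refl x => exact .refl _
  | symm x y _ ih => exact .symm _ _ ih
  | trans x y z _ _ ih₁ ih₂ => exact .trans _ _ _ ih₁ ih₂

/-- Following the boundary of `H` never leaves a component, since on `K` both subgraphs have the
same boundary arcs. This gives injectivity when boundary circles are counted by component. -/
theorem eqvGen_component (hK : K ∈ H.components) {x y : H.Corner}
    (h : Relation.EqvGen H.BdryStep x y) :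
    (G.vert x.1 ∈ K.verts ↔ G.vert y.1 ∈ K.verts) ∧
      ∀ (hx : G.vert x.1 ∈ K.verts) (hy : G.vert y.1 ∈ K.verts),
        Relation.EqvGen K.BdryStep ⟨x.1, hx⟩ ⟨y.1, hy⟩ := by
  induction h with
  | rel x y h =>
    refine ⟨?_, fun hx hy => .rel _ _ ?_⟩
    · rcases h with h | h
      · rw [h, G.vert_gap]
      · constructor
        · intro hx
          rw [h, ← component_arc_eq hK hx]
          exact K.vert_arc_mem hx
        · intro hy
          have hx : x.1 = G.arc H.edges y.1 := by rw [h, G.arc_arc]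
          rw [hx, ← component_arc_eq hK hy]
          exact K.vert_arc_mem hy
    · rcases h with h | h
      · exact Or.inl h
      · exact Or.inr (h.trans (component_arc_eq hK hx).symm)
  | refl x => exact ⟨Iff.rfl, fun _ _ => .refl _⟩
  | symm x y _ ih => exact ⟨ih.1.symm, fun hx hy => .symm _ _ (ih.2 hy hx)⟩
  | trans x y z _ _ ih₁ ih₂ =>
    exact ⟨ih₁.1.trans ih₂.1, fun hx hz =>
      .trans _ _ _ (ih₁.2 hx (ih₁.1.1 hx)) (ih₂.2 (ih₁.1.1 hx) hz)⟩

/-- A boundary component of a component of `H`, as a boundary component of `H`. -/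
def bdryOfComponent (hK : K ∈ H.components) : K.BdryComponent → H.BdryComponent :=
  Sum.map
    (Quotient.map (cornerOfComponent hK) fun _ _ h => eqvGen_cornerOfComponent hK h)
    fun v => ⟨v.1, component_verts_subset hK v.2.1, v.2.2⟩

variable (H)

theorem finite_bdryComponent [Finite V] [Finite E] : Finite H.BdryComponent := by
  have := G.finite_corners
  infer_instance

theorem sum_component_bdry [Finite V] [Finite E] :
    ∑ K ∈ H.components_finite.toFinset, Nat.card K.BdryComponent = Nat.card H.BdryComponent := by
  have := fun K : RibbonSubgraph G => K.finite_bdryComponent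
  refine Finset.sum_natCard_of_bijective _ (fun K : RibbonSubgraph G => K.BdryComponent)
    (fun x : (Σ K : H.components_finite.toFinset, K.1.BdryComponent) =>
      bdryOfComponent (H.components_finite.mem_toFinset.1 x.1.2) x.2) ⟨?_, ?_⟩
  · rintro ⟨⟨K, hK⟩, c⟩ ⟨⟨K', hK'⟩, c'⟩ h
    rw [Set.Finite.mem_toFinset] at hK hK'
    rcases c with c | ⟨v, hv⟩ <;> rcases c' with c' | ⟨v', hv'⟩
    · induction c using Quotient.inductionOn with | _ x
      induction c' using Quotient.inductionOn with | _ y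
      have hxy := Quotient.exact (Sum.inl_injective h)
      have hm := eqvGen_component hK hxy
      obtain rfl := component_eq_of_mem hK hK' (hm.1.1 x.2) y.2
      have : (Quotient.mk (Relation.EqvGen.setoid K.BdryStep) x) = Quotient.mk _ y :=
        Quotient.sound (hm.2 x.2 y.2)
      rw [this]
    · exact (Sum.inl_ne_inr h).elim
    · exact (Sum.inr_ne_inl h).elim
    · obtain rfl : v = v' := congrArg Subtype.val (Sum.inr_injective h)
      obtain rfl := component_eq_of_mem hK hK' hv.1 hv'.1
      rfl
  · rintro (c | ⟨v, hv⟩)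
    · induction c using Quotient.inductionOn with | _ x
      exact ⟨⟨⟨H.componentAt (G.vert x.1), H.components_finite.mem_toFinset.2 ⟨_, x.2, rfl⟩⟩,
        Sum.inl (Quotient.mk _ ⟨x.1, H.mem_componentAt_self x.2⟩)⟩, rfl⟩
    · exact ⟨⟨⟨H.componentAt v, H.components_finite.mem_toFinset.2 ⟨_, hv.1, rfl⟩⟩,
        Sum.inr ⟨v, H.mem_componentAt_self hv.1, hv.2⟩⟩, rfl⟩

theorem eulerGenus_eq [Finite V] [Finite E] :
    H.eulerGenus = 2 * H.components.ncard - H.cappedEulerChar := by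
  unfold eulerGenus
  rw [finsum_mem_eq_finite_toFinset_sum _ H.components_finite,
    Set.ncard_eq_toFinset_card _ H.components_finite]
  simp only [connEulerGenus_eq, cappedEulerChar, ← H.sum_component_verts,
    ← H.sum_component_edges, ← H.sum_component_bdry]
  push_cast
  simp only [Finset.sum_sub_distrib, Finset.sum_add_distrib, Finset.sum_const, nsmul_eq_mul]
  ring

end RibbonSubgraph

/-! ### Isolated discs: comparing `G.restrict A` with `G.spanning A`. -/

namespace RibbonGraph

open RibbonSubgraph

variable {V E F : Type*} (G : RibbonGraph V E F)

theorem reachable_eq_of_not_mem_restrict {A : Set E} {v w : V} (hv : v ∉ (G.restrict A).verts)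
    (h : (G.restrict A).Reachable v w) : w = v := by
  induction h using Relation.ReflTransGen.head_induction_on with
  | refl => rfl
  | head h _ _ =>
    obtain ⟨f, hf, rfl, rfl⟩ := h
    exact (hv ⟨f, hf, rfl⟩).elim

theorem componentAt_spanning_of_mem {A : Set E} {v : V} (hv : v ∈ (G.restrict A).verts) :
    (G.spanning A).componentAt v = (G.restrict A).componentAt v := by
  ext w
  · exact ⟨fun h => ⟨Reachable.mem (H := G.restrict A) h.2 hv, h.2⟩,
      fun h => ⟨Set.mem_univ _, h.2⟩⟩
  · exact Iff.rfl

theorem componentAt_spanning_of_not_mem {A : Set E} {v : V} (hv : v ∉ (G.restrict A).verts) :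
    (G.spanning A).componentAt v = G.disc v := by
  ext w
  · constructor
    · exact fun h => G.reachable_eq_of_not_mem_restrict hv h.2
    · rintro rfl
      exact ⟨Set.mem_univ _, reachable_refl _ _⟩
  · refine ⟨fun h => ?_, fun h => h.elim⟩
    obtain ⟨f, rfl⟩ := G.edge_surjective w
    exact hv ⟨f, h.1, G.reachable_eq_of_not_mem_restrict hv (h.2 f rfl)⟩

theorem components_spanning (A : Set E) :
    (G.spanning A).components = (G.restrict A).components ∪ G.disc '' (G.restrict A).vertsᶜ := by
  ext K
  constructor
  · rintro ⟨v, -, rfl⟩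
    by_cases hv : v ∈ (G.restrict A).verts
    · exact Or.inl ⟨v, hv, G.componentAt_spanning_of_mem hv⟩
    · exact Or.inr ⟨v, hv, (G.componentAt_spanning_of_not_mem hv).symm⟩
  · rintro (⟨v, hv, rfl⟩ | ⟨v, hv, rfl⟩)
    · exact ⟨v, Set.mem_univ _, (G.componentAt_spanning_of_mem hv).symm⟩
    · exact ⟨v, Set.mem_univ _, (G.componentAt_spanning_of_not_mem hv).symm⟩

theorem restrict_component_edges_nonempty {A : Set E} {K : RibbonSubgraph G}
    (hK : K ∈ (G.restrict A).components) : K.edges.Nonempty := by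
  obtain ⟨v, hv⟩ := component_verts_nonempty hK
  obtain ⟨f, hf, rfl⟩ := component_verts_subset hK hv
  exact ⟨_, (component_edge_mem_iff hK f).2 ⟨hf, hv⟩⟩

theorem disjoint_components_disc (A : Set E) (U : Set V) :
    Disjoint (G.restrict A).components (G.disc '' U) := by
  rw [Set.disjoint_left]
  rintro _ hK ⟨v, -, rfl⟩
  exact (G.restrict_component_edges_nonempty hK).ne_empty rfl

theorem ncard_components_spanning [Finite V] (A : Set E) :
    (G.spanning A).components.ncard
      = (G.restrict A).components.ncard + (G.restrict A).vertsᶜ.ncard := by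
  rw [components_spanning, Set.ncard_union_eq (G.disjoint_components_disc A _)
    (components_finite _) ((Set.toFinite _).image _), Set.ncard_image_of_injective]
  intro v w h
  exact Set.singleton_injective (congrArg RibbonSubgraph.verts h)

theorem eqvGen_disc {v : V} {f f' : F}
    (h : Relation.EqvGen (fun a b => b = G.seg a ∨ b = G.gap a) f f')
    (hf : G.vert f ∈ (G.disc v).verts) (hf' : G.vert f' ∈ (G.disc v).verts) :
    Relation.EqvGen (G.disc v).BdryStep ⟨f, hf⟩ ⟨f', hf'⟩ := by
  induction h with
  | rel x y h =>
    refine .rel _ _ ?_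
    rcases h with h | h
    · exact Or.inr (h.trans (G.arc_of_not_mem fun h => h.elim).symm)
    · exact Or.inl h
  | refl x => exact .refl _
  | symm x y _ ih => exact .symm _ _ (ih hf' hf)
  | trans x y z hxy _ ih₁ ih₂ =>
    have hy : G.vert y ∈ (G.disc v).verts := by rwa [← (G.vert_eq_iff x y).2 hxy]
    exact .trans _ _ _ (ih₁ hf hy) (ih₂ hy hf')

/-- With every edge deleted, the boundary arcs at `v` are segments and gaps, which form one circle
by `vert_eq_iff`. If `v` carries no corner, its circle is counted by the second summand instead. -/
theorem card_bdryComponent_disc (v : V) : Nat.card (G.disc v).BdryComponent = 1 := by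
  rw [Nat.card_eq_one_iff_unique]
  constructor
  · constructor
    rintro (c | ⟨w, hw, hw'⟩) (c' | ⟨u, hu, hu'⟩)
    · induction c using Quotient.inductionOn with | _ x
      induction c' using Quotient.inductionOn with | _ y
      have hxy : G.vert x.1 = G.vert y.1 := x.2.trans y.2.symm
      exact congrArg Sum.inl
        (Quotient.sound (G.eqvGen_disc ((G.vert_eq_iff _ _).1 hxy) x.2 y.2))
    · induction c using Quotient.inductionOn with | _ x
      exact (hu' x.1 (x.2.trans hu.symm)).elim
    · induction c' using Quotient.inductionOn with | _ x
      exact (hw' x.1 (x.2.trans hw.symm)).elim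
    · have : w = u := hw.trans hu.symm
      subst this
      rfl
  · by_cases h : ∃ f, G.vert f = v
    · obtain ⟨f, hf⟩ := h
      exact ⟨Sum.inl (Quotient.mk _ ⟨f, hf⟩)⟩
    · exact ⟨Sum.inr ⟨v, rfl, fun f hf => h ⟨f, hf⟩⟩⟩

theorem connEulerGenus_disc (v : V) : (G.disc v).connEulerGenus = 0 := by
  rw [connEulerGenus_eq, cappedEulerChar, card_bdryComponent_disc]
  have h₁ : (G.disc v).verts.ncard = 1 := Set.ncard_singleton v
  have h₂ : (G.disc v).edges.ncard = 0 := Set.ncard_empty E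
  rw [h₁, h₂]
  norm_num

/-- The extra components are discs of Euler genus 0, outside the support of the sum. -/
theorem eulerGenus_restrict (A : Set E) :
    (G.restrict A).eulerGenus = (G.spanning A).eulerGenus := by
  unfold RibbonSubgraph.eulerGenus
  refine finsum_mem_inter_support_eq _ _ _ ?_
  rw [components_spanning, Set.union_inter_distrib_right, eq_comm, Set.union_eq_left]
  rintro _ ⟨⟨v, -, rfl⟩, h⟩
  exact (h (G.connEulerGenus_disc v)).elim

/-! ### Connectedness and Euler genus of the partial dual. -/

/-- Of the two arcs of `G` at `f`, one is a segment of the partial dual, staying on the same vertex,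
and the other a free side, crossing an edge. Paths of `G` can thus be followed in the dual. -/
theorem spanningBdry_seg_or (A : Set E) (f : F) :
    (G.partialDual A).whole.Reachable (G.spanningBdry A f) (G.spanningBdry A (G.seg f)) ∧
    (G.partialDual A).whole.Reachable (G.spanningBdry A f) (G.spanningBdry A (G.side f)) := by
  have h₁ : (G.partialDual A).whole.Reachable (G.spanningBdry A f)
      (G.spanningBdry A (G.arc A f)) := by
    rw [(G.spanningBdry_eq_iff A f _).2 (.rel _ _ (Or.inl rfl))]
    exact reachable_refl _ _
  have h₂ : (G.partialDual A).whole.Reachable (G.spanningBdry A f)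
      (G.spanningBdry A (G.arc Aᶜ f)) :=
    Relation.ReflTransGen.single ⟨f, Set.mem_univ _, rfl, rfl⟩
  by_cases h : G.edge f ∈ A
  · rw [G.arc_of_mem h] at h₁
    rw [G.arc_compl_of_mem h] at h₂
    exact ⟨h₂, h₁⟩
  · rw [G.arc_of_not_mem h] at h₁
    rw [G.arc_compl_of_not_mem h] at h₂
    exact ⟨h₁, h₂⟩

theorem reachable_spanningBdry_of_vert_eq (A : Set E) {f f' : F} (h : G.vert f = G.vert f') :
    (G.partialDual A).whole.Reachable (G.spanningBdry A f) (G.spanningBdry A f') := by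
  have h' := (G.vert_eq_iff f f').1 h
  clear h
  induction h' with
  | rel x y h =>
    rcases h with rfl | rfl
    · exact (G.spanningBdry_seg_or A x).1
    · rw [(G.spanningBdry_eq_iff A x _).2 (.rel _ _ (Or.inr rfl))]
      exact reachable_refl _ _
  | refl x => exact reachable_refl _ _
  | symm x y _ ih => exact ih.symm
  | trans x y z _ _ ih₁ ih₂ => exact ih₁.trans ih₂

theorem reachable_spanningBdry (A : Set E) {v w : V} (h : G.whole.Reachable v w) {f f' : F}
    (hf : G.vert f = v) (hf' : G.vert f' = w) :
    (G.partialDual A).whole.Reachable (G.spanningBdry A f) (G.spanningBdry A f') := by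
  induction h using Relation.ReflTransGen.head_induction_on generalizing f with
  | refl => exact G.reachable_spanningBdry_of_vert_eq A (hf.trans hf'.symm)
  | head h _ ih =>
    obtain ⟨g, -, rfl, rfl⟩ := h
    exact (G.reachable_spanningBdry_of_vert_eq A hf).trans
      ((G.spanningBdry_seg_or A g).2.trans (ih rfl))

theorem eq_of_reachable_of_isolated {v w : V} (hv : ∀ f, G.vert f ≠ v)
    (h : G.whole.Reachable v w) : v = w := by
  induction h using Relation.ReflTransGen.head_induction_on with
  | refl => rfl
  | head h _ _ =>
    obtain ⟨g, -, rfl, -⟩ := h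
    exact (hv g rfl).elim

variable {G}

theorem Connected.partialDual (hG : G.Connected) (A : Set E) : (G.partialDual A).Connected := by
  have hr : ∀ v w, G.whole.Reachable v w := fun v w =>
    hG.2 v (Set.mem_univ _) w (Set.mem_univ _)
  constructor
  · obtain ⟨v, -⟩ := hG.1
    by_cases h : ∃ f, G.vert f = v
    · obtain ⟨f, -⟩ := h
      exact ⟨G.spanningBdry A f, Set.mem_univ _⟩
    · exact ⟨Sum.inr ⟨v, Set.mem_univ _, fun f hf => h ⟨f, hf⟩⟩, Set.mem_univ _⟩
  · rintro (c | ⟨v, hv, hv'⟩) - (c' | ⟨w, hw, hw'⟩) -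
    · induction c using Quotient.inductionOn with | _ x
      induction c' using Quotient.inductionOn with | _ y
      exact G.reachable_spanningBdry A (hr _ _) (f := x.1) (f' := y.1) rfl rfl
    · induction c using Quotient.inductionOn with | _ x
      exact (hw' x.1 (G.eq_of_reachable_of_isolated hw' (hr _ _)).symm).elim
    · induction c' using Quotient.inductionOn with | _ x
      exact (hv' x.1 (G.eq_of_reachable_of_isolated hv' (hr _ _)).symm).elim
    · obtain rfl := G.eq_of_reachable_of_isolated hv' (hr v w)
      exact reachable_refl _ _

variable (G)

theorem arc_univ (f : F) : G.arc Set.univ f = G.side f := G.arc_of_mem (Set.mem_univ _)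

/-- The boundary components of `G^A` are those of the spanning ribbon subgraph `(V(G), Aᶜ)`. -/
noncomputable def partialDualBdryEquiv (A : Set E) :
    (G.partialDual A).whole.BdryComponent ≃ (G.spanning Aᶜ).BdryComponent := by
  refine Equiv.sumCongr (Quotient.congr
    ((Equiv.refl F).subtypeEquiv fun f => iff_of_true (Set.mem_univ _) (Set.mem_univ _)) ?_) ?_
  · have h : ∀ x y : (G.partialDual A).whole.Corner, (G.partialDual A).whole.BdryStep x y ↔
        (G.spanning Aᶜ).BdryStep ⟨x.1, Set.mem_univ _⟩ ⟨y.1, Set.mem_univ _⟩ := by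
      intro x y
      have : (G.partialDual A).arc Set.univ x.1 = G.arc Aᶜ x.1 := arc_univ _ _
      unfold BdryStep
      change _ ∨ _ = (G.partialDual A).arc Set.univ x.1 ↔ _
      rw [this]
      rfl
    intro x y
    constructor
    · intro hxy
      change Relation.EqvGen _ _ _ at hxy
      change Relation.EqvGen _ _ _
      induction hxy with
      | rel x y hxy => exact .rel _ _ ((h x y).1 hxy)
      | refl x => exact .refl _
      | symm x y _ ih => exact .symm _ _ ih
      | trans x y z _ _ ih₁ ih₂ => exact .trans _ _ _ ih₁ ih₂
    · have key : ∀ x y : (G.spanning Aᶜ).Corner, Relation.EqvGen (G.spanning Aᶜ).BdryStep x y →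
          Relation.EqvGen (G.partialDual A).whole.BdryStep ⟨x.1, Set.mem_univ _⟩
            ⟨y.1, Set.mem_univ _⟩ := by
        intro x y hxy
        induction hxy with
        | rel x y hxy => exact .rel _ _ ((h _ _).2 hxy)
        | refl x => exact .refl _
        | symm x y _ ih => exact .symm _ _ ih
        | trans x y z _ _ ih₁ ih₂ => exact .trans _ _ _ ih₁ ih₂
      exact key _ _
  -- The vertices of the dual without corners are exactly those coming from cornerless vertices of
  -- `G`; every `Sum.inl` vertex has a corner.
  · refine (Equiv.ofBijective (fun v => ⟨Sum.inr ⟨v.1, Set.mem_univ _, v.2.2⟩, Set.mem_univ _,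
      fun f => Sum.inl_ne_inr⟩) ⟨?_, ?_⟩).symm
    · intro v w h
      exact Subtype.ext (congrArg Subtype.val (Sum.inr_injective (congrArg Subtype.val h)))
    · rintro ⟨c | v, -, hc⟩
      · induction c using Quotient.inductionOn with | _ x
        exact (hc x.1 rfl).elim
      · exact ⟨⟨v.1, Set.mem_univ _, v.2.2⟩, rfl⟩

theorem eulerGenus_partialDual [Finite V] [Finite E] (hG : G.Connected) (A : Set E) :
    (G.partialDual A).eulerGenus = 2 - (Nat.card (G.spanning A).BdryComponent
      - Nat.card E + Nat.card (G.spanning Aᶜ).BdryComponent) := by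
  have := (G.spanning A).finite_bdryComponent
  have h : (G.partialDual A).whole.Connected := hG.partialDual A
  rw [RibbonGraph.eulerGenus, RibbonSubgraph.eulerGenus_eq, components_of_connected h,
    cappedEulerChar, Nat.card_congr (G.partialDualBdryEquiv A)]
  simp [whole, Set.ncard_univ]

theorem eulerGenus_partialDual_eq_iff [Finite V] [Finite E] (hG : G.Connected) (A : Set E) :
    (G.partialDual A).eulerGenus = (G.restrict A).eulerGenus + (G.delete A).eulerGenus ↔
      (G.spanning A).components.ncard + (G.spanning Aᶜ).components.ncard = Nat.card V + 1 := by
  rw [G.eulerGenus_partialDual hG, eulerGenus_restrict, delete, RibbonSubgraph.eulerGenus_eq,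
    RibbonSubgraph.eulerGenus_eq, cappedEulerChar, cappedEulerChar]
  have h := Set.ncard_add_ncard_compl A
  have h' : ((A.ncard : ℚ) + (Aᶜ.ncard : ℚ)) = Nat.card E := by exact_mod_cast h
  simp only [spanning, Set.ncard_univ]
  push_cast
  constructor
  · intro h₁
    have : ((G.spanning A).components.ncard + (G.spanning Aᶜ).components.ncard : ℚ)
        = Nat.card V + 1 := by
      simp only [spanning]
      linarith
    exact_mod_cast this
  · intro h₁
    have : ((G.spanning A).components.ncard + (G.spanning Aᶜ).components.ncard : ℚ)
        = Nat.card V + 1 := by exact_mod_cast h₁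
    simp only [spanning] at this
    linarith

end RibbonGraph

/-! ### Enumerating the pieces and counting their overlaps. -/

/-- If every proper nonempty subfamily of a finite family of sets meets some member outside of it,
then the family can be listed so that each member meets one of its predecessors. -/
theorem Set.exists_enumeration_of_meets {ι α : Type*} {C : Set ι} (hC : C.Finite)
    (hne : C.Nonempty) (t : ι → Set α)
    (h : ∀ T ⊆ C, T.Nonempty → T ≠ C → ∃ K ∈ C, K ∉ T ∧ ∃ K' ∈ T, (t K' ∩ t K).Nonempty) :
    ∃ (l : ℕ) (H : ℕ → ι), Set.InjOn H (Set.Iic l) ∧ H '' Set.Iic l = C ∧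
      ∀ j < l, ∃ i ≤ j, (t (H i) ∩ t (H (j + 1))).Nonempty := by
  have key : ∀ n < C.ncard, ∃ H : ℕ → ι, Set.InjOn H (Set.Iic n) ∧ H '' Set.Iic n ⊆ C ∧
      ∀ j < n, ∃ i ≤ j, (t (H i) ∩ t (H (j + 1))).Nonempty := by
    intro n
    induction n with
    | zero =>
      intro _
      obtain ⟨K, hK⟩ := hne
      refine ⟨fun _ => K, ?_, ?_, fun j hj => (Nat.not_lt_zero j hj).elim⟩
      · intro a ha b hb _
        rw [Set.mem_Iic, Nat.le_zero] at ha hb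
        rw [ha, hb]
      · rintro _ ⟨_, _, rfl⟩
        exact hK
    | succ n ih =>
      intro hn
      obtain ⟨H, hinj, hsub, hmeet⟩ := ih (by omega)
      have hcard : (H '' Set.Iic n).ncard = n + 1 := by
        rw [hinj.ncard_image]
        simp [Set.ncard_eq_toFinset_card']
      -- The `n + 1` members listed so far are fewer than all of `C`, so another member meets one of
      -- them.
      obtain ⟨K, hK, hKn, K', ⟨i, hi, rfl⟩, hm⟩ := h (H '' Set.Iic n) hsub
        ⟨H 0, 0, Nat.zero_le n, rfl⟩ (fun he => by rw [← he, hcard] at hn; omega)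
      have hold : ∀ i ≤ n, Function.update H (n + 1) K i = H i := fun i hi =>
        Function.update_of_ne (by omega) _ _
      have hnew : Function.update H (n + 1) K (n + 1) = K := Function.update_self _ _ _
      refine ⟨Function.update H (n + 1) K, ?_, ?_, ?_⟩
      · intro a ha b hb hab
        rw [Set.mem_Iic] at ha hb
        rcases Nat.le_succ_iff.1 ha with ha | rfl <;> rcases Nat.le_succ_iff.1 hb with hb | rfl
        · rw [hold a ha, hold b hb] at hab
          exact hinj ha hb hab
        · rw [hold a ha, hnew] at hab
          exact (hKn ⟨a, ha, hab⟩).elim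
        · rw [hold b hb, hnew] at hab
          exact (hKn ⟨b, hb, hab.symm⟩).elim
        · rfl
      · rintro _ ⟨a, ha, rfl⟩
        rcases Nat.le_succ_iff.1 ha with ha | rfl
        · rw [hold a ha]
          exact hsub ⟨a, ha, rfl⟩
        · rwa [hnew]
      · intro j hj
        rcases Nat.lt_succ_iff_lt_or_eq.1 hj with hj | rfl
        · obtain ⟨i, hi, hm⟩ := hmeet j hj
          refine ⟨i, hi, ?_⟩
          rwa [hold i (by omega), hold (j + 1) hj]
        · refine ⟨i, hi, ?_⟩
          rwa [hold i hi, hnew]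
  have hpos := (Set.ncard_pos hC).2 hne
  obtain ⟨H, hinj, hsub, hmeet⟩ := key (C.ncard - 1) (by omega)
  refine ⟨_, H, hinj, Set.eq_of_subset_of_ncard_le hsub ?_ hC, hmeet⟩
  rw [hinj.ncard_image]
  simp [Set.ncard_eq_toFinset_card']
  omega

/-- Adding the sets one at a time, each contributes its size minus its overlap with the union so
far. -/
theorem Set.ncard_biUnion_add_sum_inter {α : Type*} [Finite α] (t : ℕ → Set α) (l : ℕ) :
    (⋃ i ∈ Set.Iic l, t i).ncard
        + ∑ j ∈ Finset.range l, ((⋃ i ∈ Set.Iic j, t i) ∩ t (j + 1)).ncard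
      = ∑ i ∈ Finset.range (l + 1), (t i).ncard := by
  induction l with
  | zero => simp
  | succ l ih =>
    have hu : (⋃ i ∈ Set.Iic (l + 1), t i) = (⋃ i ∈ Set.Iic l, t i) ∪ t (l + 1) := by
      ext x
      simp only [Set.mem_iUnion, Set.mem_Iic, Set.mem_union, exists_prop]
      constructor
      · rintro ⟨i, hi, hx⟩
        rcases Nat.le_succ_iff.1 hi with hi | rfl
        · exact Or.inl ⟨i, hi, hx⟩
        · exact Or.inr hx
      · rintro (⟨i, hi, hx⟩ | hx)
        · exact ⟨i, by omega, hx⟩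
        · exact ⟨_, le_rfl, hx⟩
    rw [Finset.sum_range_succ, Finset.sum_range_succ _ (l + 1), ← ih, hu]
    have := Set.ncard_union_add_ncard_inter (⋃ i ∈ Set.Iic l, t i) (t (l + 1))
    omega

namespace RibbonGraph

open RibbonSubgraph

variable {V E F : Type*} (G : RibbonGraph V E F)

theorem disjoint_components_restrict_compl (A : Set E) :
    Disjoint (G.restrict A).components (G.restrict Aᶜ).components := by
  rw [Set.disjoint_left]
  intro K hK hK'
  obtain ⟨e, he⟩ := G.restrict_component_edges_nonempty hK
  exact component_edges_subset hK' he (component_edges_subset hK he)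

/-- The components of `G|_A` and of `G|_{Aᶜ}`. -/
def pieces (A : Set E) : Set (RibbonSubgraph G) :=
  (G.restrict A).components ∪ (G.restrict Aᶜ).components

variable {G} {A : Set E}

theorem pieces_finite [Finite V] : (G.pieces A).Finite :=
  (components_finite _).union (components_finite _)

theorem connected_of_mem_pieces {K : RibbonSubgraph G} (hK : K ∈ G.pieces A) : K.Connected :=
  hK.elim component_connected component_connected

theorem edges_nonempty_of_mem_pieces {K : RibbonSubgraph G} (hK : K ∈ G.pieces A) :
    K.edges.Nonempty :=
  hK.elim G.restrict_component_edges_nonempty G.restrict_component_edges_nonempty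

theorem exists_mem_pieces (f : F) : ∃ K ∈ G.pieces A, G.edge f ∈ K.edges := by
  by_cases h : G.edge f ∈ A
  · have hK : (G.restrict A).componentAt (G.vert f) ∈ (G.restrict A).components :=
      ⟨_, ⟨f, h, rfl⟩, rfl⟩
    exact ⟨_, Or.inl hK, (component_edge_mem_iff hK f).2
      ⟨h, mem_componentAt_self _ ⟨f, h, rfl⟩⟩⟩
  · have hK : (G.restrict Aᶜ).componentAt (G.vert f) ∈ (G.restrict Aᶜ).components :=
      ⟨_, ⟨f, h, rfl⟩, rfl⟩
    exact ⟨_, Or.inr hK, (component_edge_mem_iff hK f).2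
      ⟨h, mem_componentAt_self _ ⟨f, h, rfl⟩⟩⟩

theorem eq_of_mem_pieces {K K' : RibbonSubgraph G} (hK : K ∈ G.pieces A) (hK' : K' ∈ G.pieces A)
    {e : E} (he : e ∈ K.edges) (he' : e ∈ K'.edges) : K = K' := by
  obtain ⟨f, rfl⟩ := G.edge_surjective e
  have hv := K.vert_mem f he
  have hv' := K'.vert_mem f he'
  rcases hK with hK | hK <;> rcases hK' with hK' | hK'
  · exact component_eq_of_mem hK hK' hv hv'
  · exact (component_edges_subset hK' he' (component_edges_subset hK he)).elim
  · exact (component_edges_subset hK he (component_edges_subset hK' he')).elim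
  · exact component_eq_of_mem hK hK' hv hv'

theorem sum_pieces_verts [Finite V] :
    ∑ K ∈ (pieces_finite (G := G) (A := A)).toFinset, K.verts.ncard
      = (G.restrict A).verts.ncard + (G.restrict Aᶜ).verts.ncard := by
  classical
  rw [← sum_component_verts, ← sum_component_verts, ← Finset.sum_union]
  · congr 1
    ext K
    simp [pieces]
  · rw [Set.Finite.disjoint_toFinset]
    exact G.disjoint_components_restrict_compl A

theorem ncard_pieces [Finite V] : (G.pieces A).ncard
    = (G.restrict A).components.ncard + (G.restrict Aᶜ).components.ncard :=
  Set.ncard_union_eq (G.disjoint_components_restrict_compl A) (components_finite _)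
    (components_finite _)

/-- The numerical condition, in terms of an enumeration of the pieces. -/
theorem ncard_components_eq_iff_sum [Finite V] {l : ℕ} {H : ℕ → RibbonSubgraph G}
    (hinj : Set.InjOn H (Set.Iic l)) (himg : H '' Set.Iic l = G.pieces A) :
    (G.spanning A).components.ncard + (G.spanning Aᶜ).components.ncard = Nat.card V + 1 ↔
      Nat.card V + l = ∑ i ∈ Finset.range (l + 1), (H i).verts.ncard := by
  classical
  have hl : l + 1 = (G.restrict A).components.ncard + (G.restrict Aᶜ).components.ncard := by
    rw [← ncard_pieces, ← himg, hinj.ncard_image]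
    simp [Set.ncard_eq_toFinset_card']
  have hs : ∑ i ∈ Finset.range (l + 1), (H i).verts.ncard
      = (G.restrict A).verts.ncard + (G.restrict Aᶜ).verts.ncard := by
    rw [← sum_pieces_verts]
    have : (pieces_finite (G := G) (A := A)).toFinset = (Finset.range (l + 1)).image H := by
      ext K
      simp [← himg]
    rw [this, Finset.sum_image]
    intro a ha b hb hab
    simp only [Finset.coe_range, Set.mem_Iio, Nat.lt_succ_iff] at ha hb
    exact hinj ha hb hab
  -- The number of components of a spanning subgraph is its number of pieces plus its number of
  -- uncovered vertices; there are `l + 1` pieces in all.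
  rw [ncard_components_spanning, ncard_components_spanning, hs]
  have h₁ := Set.ncard_add_ncard_compl (G.restrict A).verts
  have h₂ := Set.ncard_add_ncard_compl (G.restrict Aᶜ).verts
  omega

theorem restrict_empty_verts : (G.restrict ∅).verts = ∅ := by
  ext v
  simp [restrict]

theorem ncard_components_of_eq_empty [Finite V] (hG : G.Connected) :
    (G.spanning ∅).components.ncard + (G.spanning Set.univ).components.ncard
      = Nat.card V + 1 := by
  have h₁ : (G.restrict ∅).components = ∅ := by
    rw [Set.eq_empty_iff_forall_notMem]
    rintro _ ⟨v, hv, -⟩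
    rwa [restrict_empty_verts] at hv
  have h₂ : (G.spanning Set.univ).components = {G.whole} := components_of_connected hG
  rw [ncard_components_spanning, h₁, restrict_empty_verts, h₂]
  simp [Set.ncard_univ]

theorem ncard_components_of_definesBiseparation [Finite V] (hG : G.Connected)
    (h : G.DefinesBiseparation A) :
    (G.spanning A).components.ncard + (G.spanning Aᶜ).components.ncard = Nat.card V + 1 := by
  rcases h with rfl | rfl | ⟨l, H, S, hinj, himg, h0, hl, hstep⟩
  · rw [add_comm, Set.compl_univ]
    exact ncard_components_of_eq_empty hG
  · rw [Set.compl_empty]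
    exact ncard_components_of_eq_empty hG
  · rw [ncard_components_eq_iff_sum hinj himg]
    -- Each of the `j` 1-sums identifies one vertex.
    have key : ∀ j ≤ l,
        (S j).verts.ncard + j = ∑ i ∈ Finset.range (j + 1), (H i).verts.ncard := by
      intro j
      induction j with
      | zero => simp [h0]
      | succ j ih =>
        intro hj
        obtain ⟨v, hv, -⟩ := hstep j hj
        rw [Finset.sum_range_succ, ← ih (by omega), hv.verts_union]
        have := Set.ncard_union_add_ncard_inter (S j).verts (H (j + 1)).verts
        rw [hv.verts_inter, Set.ncard_singleton] at this
        omega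
    rw [← key l le_rfl, hl]
    simp [whole, Set.ncard_univ]

/-- The union of the first `j + 1` members of a sequence of ribbon subgraphs. -/
def unionUpTo (H : ℕ → RibbonSubgraph G) (j : ℕ) : RibbonSubgraph G where
  verts := ⋃ i ∈ Set.Iic j, (H i).verts
  edges := ⋃ i ∈ Set.Iic j, (H i).edges
  vert_mem := fun f hf => by
    simp only [Set.mem_iUnion] at hf ⊢
    obtain ⟨i, hi, h⟩ := hf
    exact ⟨i, hi, (H i).vert_mem f h⟩

theorem _root_.RibbonSubgraph.Reachable.mono {H K : RibbonSubgraph G} (h : H.edges ⊆ K.edges)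
    {v w : V} (hr : H.Reachable v w) : K.Reachable v w :=
  Relation.ReflTransGen.mono (r := H.Adj) (p := K.Adj)
    (fun _ _ ⟨f, hf, h₁, h₂⟩ => ⟨f, h hf, h₁, h₂⟩) _ _ hr

theorem mem_unionUpTo_verts {H : ℕ → RibbonSubgraph G} {j : ℕ} {v : V} :
    v ∈ (unionUpTo H j).verts ↔ ∃ i ≤ j, v ∈ (H i).verts := by
  simp [unionUpTo]

theorem mem_unionUpTo_edges {H : ℕ → RibbonSubgraph G} {j : ℕ} {e : E} :
    e ∈ (unionUpTo H j).edges ↔ ∃ i ≤ j, e ∈ (H i).edges := by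
  simp [unionUpTo]

theorem exists_le_succ_iff {p : ℕ → Prop} {j : ℕ} :
    (∃ i ≤ j + 1, p i) ↔ (∃ i ≤ j, p i) ∨ p (j + 1) := by
  constructor
  · rintro ⟨i, hi, hx⟩
    rcases Nat.le_succ_iff.1 hi with hi | rfl
    · exact Or.inl ⟨i, hi, hx⟩
    · exact Or.inr hx
  · rintro (⟨i, hi, hx⟩ | hx)
    · exact ⟨i, by omega, hx⟩
    · exact ⟨_, le_rfl, hx⟩

theorem unionUpTo_connected {H : ℕ → RibbonSubgraph G} (l : ℕ)
    (hH : ∀ i ≤ l, (H i).Connected)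
    (hm : ∀ j < l, ∃ i ≤ j, ((H i).verts ∩ (H (j + 1)).verts).Nonempty) :
    (unionUpTo H l).Connected := by
  have hsub : ∀ i ≤ l, (H i).edges ⊆ (unionUpTo H l).edges := fun i hi e he =>
    mem_unionUpTo_edges.2 ⟨i, hi, he⟩
  obtain ⟨u, hu⟩ := (hH 0 (Nat.zero_le l)).1
  have key : ∀ j ≤ l, ∀ i ≤ j, ∀ v ∈ (H i).verts, (unionUpTo H l).Reachable u v := by
    intro j
    induction j with
    | zero =>
      intro hj i hi v hv
      obtain rfl := Nat.le_zero.1 hi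
      exact ((hH 0 hj).2 u hu v hv).mono (hsub 0 hj)
    | succ j ih =>
      intro hj i hi v hv
      rcases Nat.le_succ_iff.1 hi with hi | rfl
      · exact ih (by omega) i hi v hv
      · obtain ⟨k, hk, w, hw, hw'⟩ := hm j hj
        exact (ih (by omega) k hk w hw).trans (((hH _ hj).2 w hw' v hv).mono (hsub _ hj))
  refine ⟨⟨u, mem_unionUpTo_verts.2 ⟨0, Nat.zero_le l, hu⟩⟩, fun v hv w hw => ?_⟩
  obtain ⟨i, hi, hv⟩ := mem_unionUpTo_verts.1 hv
  obtain ⟨k, hk, hw⟩ := mem_unionUpTo_verts.1 hw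
  exact (key l le_rfl i hi v hv).symm.trans (key l le_rfl k hk w hw)

theorem eq_univ_of_reachable_closed (hG : G.Connected) {U : Set V} (hne : U.Nonempty)
    (hU : ∀ f, G.vert f ∈ U → G.vert (G.side f) ∈ U) : U = Set.univ := by
  obtain ⟨u, hu⟩ := hne
  refine Set.eq_univ_of_forall fun v => ?_
  have hr : G.whole.Reachable u v := hG.2 u (Set.mem_univ _) v (Set.mem_univ _)
  induction hr with
  | refl => exact hu
  | tail _ h ih =>
    obtain ⟨f, -, rfl, rfl⟩ := h
    exact hU f ih

/-- Otherwise the vertices covered by `T` are closed under adjacency: a piece containing an edge at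
such a vertex meets `T`, hence lies in `T`. Then `T` covers all vertices, so every piece meets `T`
and belongs to it. -/
theorem exists_piece_meeting (hG : G.Connected) {T : Set (RibbonSubgraph G)}
    (hT : T ⊆ G.pieces A) (hne : T.Nonempty) (hT' : T ≠ G.pieces A) :
    ∃ K ∈ G.pieces A, K ∉ T ∧ ∃ K' ∈ T, (K'.verts ∩ K.verts).Nonempty := by
  by_contra! hcon
  have hstay : ∀ K ∈ G.pieces A, ∀ K' ∈ T, ∀ v ∈ K'.verts, v ∈ K.verts → K ∈ T := by
    intro K hK K' hK' v hv hv'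
    by_contra hKT
    exact (Set.eq_empty_iff_forall_notMem.1 (hcon K hK hKT K' hK')) v ⟨hv, hv'⟩
  have huniv : (⋃ K ∈ T, K.verts) = Set.univ := by
    refine eq_univ_of_reachable_closed hG ?_ fun f hf => ?_
    · obtain ⟨K, hK⟩ := hne
      obtain ⟨v, hv⟩ := (connected_of_mem_pieces (hT hK)).1
      exact ⟨v, Set.mem_biUnion hK hv⟩
    · obtain ⟨K', hK', hv⟩ := Set.mem_iUnion₂.1 hf
      obtain ⟨K, hK, he⟩ := exists_mem_pieces (G := G) (A := A) f
      exact Set.mem_biUnion (hstay K hK K' hK' _ hv (K.vert_mem f he))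
        (K.vert_mem _ (by rwa [G.edge_side]))
  refine hT' (hT.antisymm fun K hK => ?_)
  obtain ⟨v, hv⟩ := (connected_of_mem_pieces hK).1
  obtain ⟨K', hK', hv'⟩ := Set.mem_iUnion₂.1 (huniv ▸ Set.mem_univ v : v ∈ ⋃ K ∈ T, K.verts)
  exact hstay K hK K' hK' v hv' hv

theorem unionUpTo_eq_whole (hG : G.Connected) {l : ℕ} {H : ℕ → RibbonSubgraph G}
    (himg : H '' Set.Iic l = G.pieces A) : unionUpTo H l = G.whole := by
  have hpiece : ∀ K ∈ G.pieces A, ∃ i ≤ l, H i = K := fun K hK => by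
    rw [← himg] at hK
    exact hK
  have he : ∀ f, G.edge f ∈ (unionUpTo H l).edges := fun f => by
    obtain ⟨K, hK, he⟩ := exists_mem_pieces (G := G) (A := A) f
    obtain ⟨i, hi, rfl⟩ := hpiece K hK
    exact mem_unionUpTo_edges.2 ⟨i, hi, he⟩
  have hv : (unionUpTo H l).verts = Set.univ := by
    refine eq_univ_of_reachable_closed hG ?_ fun f _ => (unionUpTo H l).vert_mem _ (he _)
    have h0 : H 0 ∈ G.pieces A := himg ▸ ⟨0, Nat.zero_le l, rfl⟩
    obtain ⟨v, hv⟩ := (connected_of_mem_pieces h0).1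
    exact ⟨v, mem_unionUpTo_verts.2 ⟨0, Nat.zero_le l, hv⟩⟩
  ext x
  · rw [hv]
    rfl
  · obtain ⟨f, rfl⟩ := G.edge_surjective x
    exact iff_of_true (he f) (Set.mem_univ _)

/-- Distinct components on the same side are disjoint, so pieces sharing a vertex come from opposite
sides. -/
theorem pieces_alternate {K K' : RibbonSubgraph G} (hK : K ∈ G.pieces A) (hK' : K' ∈ G.pieces A)
    (hne : K ≠ K') {v : V} (hv : v ∈ K.verts) (hv' : v ∈ K'.verts) :
    (K ∈ (G.restrict A).components ∧ K' ∈ (G.restrict Aᶜ).components) ∨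
      (K ∈ (G.restrict Aᶜ).components ∧ K' ∈ (G.restrict A).components) := by
  rcases hK with hK | hK <;> rcases hK' with hK' | hK'
  · exact (hne (component_eq_of_mem hK hK' hv hv')).elim
  · exact Or.inl ⟨hK, hK'⟩
  · exact Or.inr ⟨hK, hK'⟩
  · exact (hne (component_eq_of_mem hK hK' hv hv')).elim

theorem definesBiseparation_of_ncard_components [Finite V] (hG : G.Connected)
    (h : (G.spanning A).components.ncard + (G.spanning Aᶜ).components.ncard = Nat.card V + 1) :
    G.DefinesBiseparation A := by
  -- An edge guarantees a nonempty list of pieces. The case `A = Set.univ` needs no separate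
  -- treatment.
  rcases A.eq_empty_or_nonempty with hA | ⟨e, he⟩
  · exact Or.inr (Or.inl hA)
  obtain ⟨f, rfl⟩ := G.edge_surjective e
  obtain ⟨K, hK, -⟩ := exists_mem_pieces (G := G) (A := A) f
  obtain ⟨l, H, hinj, himg, hmeet⟩ := Set.exists_enumeration_of_meets pieces_finite ⟨K, hK⟩
    RibbonSubgraph.verts fun T => exists_piece_meeting (A := A) hG (T := T)
  have hmem : ∀ i ≤ l, H i ∈ G.pieces A := fun i hi => himg ▸ ⟨i, hi, rfl⟩
  have hwhole := unionUpTo_eq_whole hG himg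
  rw [ncard_components_eq_iff_sum hinj himg, ← Set.ncard_biUnion_add_sum_inter] at h
  have hV : (⋃ i ∈ Set.Iic l, (H i).verts).ncard = Nat.card V := by
    rw [← Set.ncard_univ]
    exact congrArg (fun K : RibbonSubgraph G => K.verts.ncard) hwhole
  rw [hV, add_right_inj] at h
  have hmeet' : ∀ j < l, ((unionUpTo H j).verts ∩ (H (j + 1)).verts).Nonempty := by
    intro j hj
    obtain ⟨i, hi, v, hv, hv'⟩ := hmeet j hj
    exact ⟨v, mem_unionUpTo_verts.2 ⟨i, hi, hv⟩, hv'⟩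
  -- The `l` overlaps are each at least 1 and sum to `l`.
  have hone : ∀ j < l, ((unionUpTo H j).verts ∩ (H (j + 1)).verts).ncard = 1 := by
    have := (Finset.sum_eq_sum_iff_of_le (s := Finset.range l) (f := fun _ => 1)
      (g := fun j => ((unionUpTo H j).verts ∩ (H (j + 1)).verts).ncard)
      fun j hj => (Set.ncard_pos).2 (hmeet' j (Finset.mem_range.1 hj))).1
      (by rw [Finset.sum_const, Finset.card_range, smul_eq_mul, mul_one]; exact h)
    exact fun j hj => (this j (Finset.mem_range.2 hj)).symm
  refine Or.inr (Or.inr ⟨l, H, unionUpTo H, hinj, himg, ?_, hwhole, fun j hj => ?_⟩)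
  · ext x
    · simp [mem_unionUpTo_verts]
    · simp [mem_unionUpTo_edges]
  · obtain ⟨v, hv⟩ := Set.ncard_eq_one.1 (hone j hj)
    obtain ⟨hvS, hvH⟩ : v ∈ (unionUpTo H j).verts ∩ (H (j + 1)).verts := by
      rw [hv]
      rfl
    obtain ⟨i, hi, hvi⟩ := mem_unionUpTo_verts.1 hvS
    have hne : ∀ i ≤ j, H i ≠ H (j + 1) := fun i hi heq => by
      have := hinj (Set.mem_Iic.2 (by omega)) (Set.mem_Iic.2 hj) heq
      omega
    refine ⟨v, ⟨?_, connected_of_mem_pieces (hmem _ hj), ?_,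
      edges_nonempty_of_mem_pieces (hmem _ hj), ?_, ?_, hv, ?_⟩, i, hi, hvi, ?_⟩
    · exact unionUpTo_connected j (fun i hi => connected_of_mem_pieces (hmem i (by omega)))
        fun k hk => hmeet k (by omega)
    · obtain ⟨e, he⟩ := edges_nonempty_of_mem_pieces (hmem 0 (Nat.zero_le l))
      exact ⟨e, mem_unionUpTo_edges.2 ⟨0, Nat.zero_le j, he⟩⟩
    · ext x
      rw [Set.mem_union, mem_unionUpTo_verts, mem_unionUpTo_verts, exists_le_succ_iff]
    · ext x
      rw [Set.mem_union, mem_unionUpTo_edges, mem_unionUpTo_edges, exists_le_succ_iff]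
    · rw [Set.eq_empty_iff_forall_notMem]
      rintro x ⟨hx, hx'⟩
      obtain ⟨k, hk, hxk⟩ := mem_unionUpTo_edges.1 hx
      exact hne k hk (eq_of_mem_pieces (hmem k (by omega)) (hmem _ hj) hxk hx')
    · exact pieces_alternate (hmem i (by omega)) (hmem _ hj) (hne i hi) hvi hvH

/-! ### Orientability. -/

/-- The same function `o` serves for both: the two unordered pairs of arcs at each corner agree. -/
theorem orientable_partialDual_iff : (G.partialDual A).Orientable ↔ G.Orientable := by
  refine exists_congr fun o => ?_
  have key : ∀ f, (o (G.arc A f) = !(o f) ∧ o (G.arc Aᶜ f) = !(o f)) ↔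
      (o (G.seg f) = !(o f) ∧ o (G.side f) = !(o f)) := by
    intro f
    by_cases h : G.edge f ∈ A
    · rw [G.arc_of_mem h, G.arc_compl_of_mem h, and_comm]
    · rw [G.arc_of_not_mem h, G.arc_compl_of_not_mem h]
  constructor
  · rintro ⟨h₁, h₂⟩
    have h := fun f => (key f).1 ⟨(h₁ f (Set.mem_univ _)).1, h₂ f (Set.mem_univ _)⟩
    exact ⟨fun f _ => ⟨(h f).1, (h₁ f (Set.mem_univ _)).2⟩, fun f _ => (h f).2⟩
  · rintro ⟨h₁, h₂⟩
    have h := fun f => (key f).2 ⟨(h₁ f (Set.mem_univ _)).1, h₂ f (Set.mem_univ _)⟩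
    exact ⟨fun f _ => ⟨(h f).1, (h₁ f (Set.mem_univ _)).2⟩, fun f _ => (h f).2⟩

theorem _root_.RibbonSubgraph.Orientable.mono {H K : RibbonSubgraph G} (hK : K.Orientable)
    (hv : H.verts ⊆ K.verts) (he : H.edges ⊆ K.edges) : H.Orientable := by
  obtain ⟨o, h₁, h₂⟩ := hK
  exact ⟨o, fun f hf => h₁ f (hv hf), fun f hf => h₂ f (he hf)⟩

/-- Two orientations of a vertex disc agree up to a global flip. -/
theorem xor_eq_of_vert_eq {v : V} {o o' : F → Bool}
    (h : ∀ f, G.vert f = v → o (G.seg f) = !(o f) ∧ o (G.gap f) = !(o f))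
    (h' : ∀ f, G.vert f = v → o' (G.seg f) = !(o' f) ∧ o' (G.gap f) = !(o' f))
    {f f' : F} (hf : G.vert f = v) (hf' : G.vert f' = v) :
    xor (o f) (o' f) = xor (o f') (o' f') := by
  have hg := (G.vert_eq_iff f f').1 (hf.trans hf'.symm)
  -- Both orientations change along every segment and gap, so their `xor` is constant around the
  -- circle.
  induction hg with
  | rel x y hxy =>
    rcases hxy with rfl | rfl
    · rw [(h x hf).1, (h' x hf).1]
      simp
    · rw [(h x hf).2, (h' x hf).2]
      simp
  | refl x => rfl
  | symm x y _ ih => exact (ih hf' hf).symm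
  | trans x y z hxy _ ih₁ ih₂ =>
    have hy : G.vert y = v := by rw [← hf, (G.vert_eq_iff x y).2 hxy]
    exact (ih₁ hf hy).trans (ih₂ hy hf')

/-- At the only shared vertex the two orientations differ by a constant flip `b`; applying `b` to
all of `Q` makes them agree. -/
theorem _root_.RibbonSubgraph.IsOneSumAt.orientable {T P Q : RibbonSubgraph G} {v : V}
    (h : IsOneSumAt T P Q v) (hP : P.Orientable) (hQ : Q.Orientable) : T.Orientable := by
  classical
  obtain ⟨o, h₁, h₂⟩ := hP
  obtain ⟨o', h₁', h₂'⟩ := hQ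
  obtain ⟨hvP, hvQ⟩ : v ∈ P.verts ∩ Q.verts := by
    rw [h.verts_inter]
    rfl
  have hflip : ∃ b : Bool, ∀ f, G.vert f = v → o f = xor b (o' f) := by
    by_cases hf : ∃ f, G.vert f = v
    · obtain ⟨f₀, hf₀⟩ := hf
      refine ⟨xor (o f₀) (o' f₀), fun f hf => ?_⟩
      rw [xor_eq_of_vert_eq (fun f hf => h₁ f (hf ▸ hvP)) (fun f hf => h₁' f (hf ▸ hvQ)) hf₀ hf]
      simp
    · exact ⟨false, fun f hf' => (hf ⟨f, hf'⟩).elim⟩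
  obtain ⟨b, hb⟩ := hflip
  -- The glued function is the flipped `o'` on all of `Q`, including at `v`, where it is defined by
  -- `o`.
  have hoQ : ∀ f, G.vert f ∈ Q.verts →
      (if G.vert f ∈ P.verts then o f else xor b (o' f)) = xor b (o' f) := by
    intro f hf
    split_ifs with hfP
    · have : G.vert f ∈ P.verts ∩ Q.verts := ⟨hfP, hf⟩
      rw [h.verts_inter] at this
      exact hb f this
    · rfl
  refine ⟨fun f => if G.vert f ∈ P.verts then o f else xor b (o' f), fun f hf => ?_,
    fun f hf => ?_⟩
  · rw [h.verts_union] at hf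
    by_cases hfP : G.vert f ∈ P.verts
    · simpa only [G.vert_seg, G.vert_gap, if_pos hfP] using h₁ f hfP
    · obtain ⟨hs, hg⟩ := h₁' f (hf.resolve_left hfP)
      simp only [G.vert_seg, G.vert_gap, if_neg hfP, hs, hg, Bool.xor_not, and_self]
  · rw [h.edges_union] at hf
    rcases hf with hf | hf
    · simpa only [if_pos (P.vert_mem f hf),
        if_pos (P.vert_mem (G.side f) (by rwa [G.edge_side]))] using h₂ f hf
    · beta_reduce
      rw [hoQ f (Q.vert_mem f hf), hoQ (G.side f) (Q.vert_mem _ (by rwa [G.edge_side])),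
        h₂' f hf, Bool.xor_not]

theorem orientable_of_definesBiseparation (h : G.DefinesBiseparation A)
    (h₁ : (G.restrict A).Orientable) (h₂ : (G.delete A).Orientable) : G.Orientable := by
  rcases h with rfl | rfl | ⟨l, H, S, -, himg, h0, hl, hstep⟩
  · obtain ⟨o, ho, ho'⟩ := h₁
    -- Vertices missing from `G.restrict Set.univ` carry no corner and impose no condition.
    exact ⟨o, fun f _ => ho f ⟨f, Set.mem_univ _, rfl⟩, ho'⟩
  · exact h₂.mono subset_rfl fun _ _ h => h
  · have hH : ∀ i ≤ l, (H i).Orientable := by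
      intro i hi
      have hi : H i ∈ G.pieces A := (himg ▸ ⟨i, hi, rfl⟩ : H i ∈ _ ∪ _)
      rcases hi with hi | hi
      · exact h₁.mono (component_verts_subset hi) (component_edges_subset hi)
      · have he := component_edges_subset hi
        exact h₂.mono (Set.subset_univ _) he
    have hS : ∀ j ≤ l, (S j).Orientable := by
      intro j
      induction j with
      | zero => exact fun _ => h0 ▸ hH 0 (Nat.zero_le l)
      | succ j ih =>
        intro hj
        obtain ⟨v, hv, -⟩ := hstep j hj
        exact hv.orientable (ih (by omega)) (hH _ hj)
    have := hS l le_rfl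
    rwa [hl] at this

end RibbonGraph

theorem theorem3p3 {V E F : Type*} [Finite V] [Finite E] (G : RibbonGraph V E F)
    (hG : G.Connected) (A : Set E) :
    (G.DefinesBiseparation A ↔
      (G.partialDual A).eulerGenus = (G.restrict A).eulerGenus + (G.delete A).eulerGenus) ∧
    (G.DefinesBiseparation A →
      ((G.partialDual A).Orientable ↔
        (G.restrict A).Orientable ∧ (G.delete A).Orientable)) := by
  refine ⟨?_, fun h => ?_⟩
  · rw [G.eulerGenus_partialDual_eq_iff hG]
    exact ⟨RibbonGraph.ncard_components_of_definesBiseparation hG,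
      RibbonGraph.definesBiseparation_of_ncard_components hG⟩
  · rw [RibbonGraph.orientable_partialDual_iff]
    exact ⟨fun hO => ⟨hO.mono (Set.subset_univ _) (Set.subset_univ _),
        hO.mono (Set.subset_univ _) (Set.subset_univ _)⟩,
      fun hO => RibbonGraph.orientable_of_definesBiseparation h hO.1 hO.2⟩
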